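/- Let $\mathcal{A}$ be a finite set with the discrete topology, let $\sigma\colon\mathcal{A}^{\mathbb{Z}}\to\mathcal{A}^{\mathbb{Z}}$, $(\sigma x)_i=x_{i+1}$, be the left shift, and let $X\subset\mathcal{A}^{\mathbb{Z}}$ be a subshift, that is, a closed set (for the product topology) with $\sigma X=X$. Let $P_X(n)$ be the number of words $w\in\mathcal{A}^n$ such that $x_i=w_i$ for all $0\le i<n$, for some $x\in X$. Let $\mathrm{Aut}(X)$ be the group of all homeomorphisms of $X$ that commute with $\sigma|_X$. Call $x\in X$ aperiodic if there is no integer $p>0$ with $\sigma^p x=x$. Suppose that the aperiodic points of $X$ are dense in $X$ and that $$P_X(n)=o\!\left(\frac{n^2}{\log^2 n}\right)\qquad(n\to\infty).$$ Then $\mathrm{Aut}(X)$ is amenable as a countable discrete group: $\mathrm{Aut}(X)$ is countable and there is a sequence $(F_k)_{k\in\mathbb{N}}$ of finite subsets of $\mathrm{Aut}(X)$ such that every $g\in\mathrm{Aut}(X)$ belongs to all but finitely many of the sets $F_k$, and $$\lim_{k\to\infty}\frac{|F_k\,\triangle\,gF_k|}{|F_k|}=0\qquad\text{for every } g\in\mathrm{Aut}(X).$$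 -/

import Mathlib

namespace SubshiftAut

open SymbolicDynamics.FullShift

section Subshifts

variable {A : Type*} [TopologicalSpace A]

/-- The points of the two-sided subshift `X`, with the subspace topology of `A ^ ℤ`. -/
abbrev Points (X : Subshift A ℤ) : Type _ := X.carrier

/-- The left shift `(σ x) i = x (i + 1)` as a homeomorphism of the subshift `X`. -/
def shiftHomeo (X : Subshift A ℤ) : Points X ≃ₜ Points X where
  toFun x := ⟨shift 1 x.1, X.mapsTo 1 x.2⟩
  invFun x := ⟨shift (-1) x.1, X.mapsTo (-1) x.2⟩
  left_inv x := by ext i; simp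
  right_inv x := by ext i; simp
  continuous_toFun := by fun_prop
  continuous_invFun := by fun_prop

/-- `Aut X`: the centralizer of the shift in the group of homeomorphisms of `X`. -/
abbrev Aut (X : Subshift A ℤ) : Subgroup (Points X ≃ₜ Points X) :=
  Subgroup.centralizer {shiftHomeo X}

/-- The words `w = (w₀, …, w_{n-1})` of length `n` whose cylinder meets `X`. -/
def language (X : Subshift A ℤ) (n : ℕ) : Set (Fin n → A) :=
  {w | ∃ x ∈ X.carrier, ∀ i : Fin n, x ((i : ℕ) : ℤ) = w i}

/-- The complexity function `P_X(n)`: the number of words of length `n` in the language. -/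
noncomputable def complexity (X : Subshift A ℤ) (n : ℕ) : ℕ :=
  (language X n).ncard

/-- `x` is aperiodic: there is no `p > 0` with `σ ^ p x = x`. -/
def IsAperiodic (x : ℤ → A) : Prop :=
  ∀ p : ℕ, 0 < p → (shift (1 : ℤ))^[p] x ≠ x

/-- The aperiodic points of `X` are dense in `X`. -/
def HasDenseAperiodicPoints (X : Subshift A ℤ) : Prop :=
  Dense {x : Points X | IsAperiodic x.1}

end Subshifts

section Amenability

open Filter Topology
open scoped Pointwise symmDiff

open scoped Classical in
/-- A sequence of finite subsets of `G` that eventually contains every element of `G` and is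
asymptotically invariant under left translations. The first condition makes all but finitely many
`F k` nonempty. -/
def IsFolnerSequence {G : Type*} [Group G] (F : ℕ → Finset G) : Prop :=
  (∀ g : G, ∀ᶠ k in atTop, g ∈ F k) ∧
  ∀ g : G, Tendsto (fun k => ((F k ∆ (g • F k)).card : ℝ) / ((F k).card : ℝ)) atTop (𝓝 0)

/-- Amenability of a countable discrete group: existence of a Følner sequence. -/
def IsAmenable (G : Type*) [Group G] : Prop :=
  Countable G ∧ ∃ F : ℕ → Finset G, IsFolnerSequence F

end Amenability

end SubshiftAut

/-! Let `B r` be the set of automorphisms that, with their inverses, have range `r`. These sets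
exhaust the group and ranges add under composition, so log |B r| = o(r) yields a Følner sequence
(`isAmenable_of_subexponential`).

The growth bound rests on rigidity (`eq_one_of_fixes_rightSpecial`). Between right special words of
length `k` a point is forced letter by letter, and an aperiodic point has such words arbitrarily far
to the left. Density of aperiodic points then lets an automorphism be recovered from its action near
one-letter extensions of right special words. There are at most 2(P(k+1) - P(k)) of these, and
averaging over 4r ≤ k < 8r makes this at most P(8r)/(2r) for some `k`. Hence log |B r| ≤ P(8r)/(2r)
· log P(10r) = o(r / log r). -/

namespace SubshiftAut

/-! ### Subexponential growth and Følner sequences -/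

section Folner

open Filter Topology
open scoped Pointwise symmDiff

/-- A sequence of numbers of subexponential growth is almost constant on arbitrarily long
intervals. -/
theorem exists_ratio_le_of_subexponential {c : ℕ → ℝ} (hpos : ∀ n, 1 ≤ c n)
    (hsub : ∀ ε : ℝ, 0 < ε → ∀ᶠ n : ℕ in atTop, Real.log (c n) ≤ ε * n)
    (m : ℕ) {δ : ℝ} (hδ : 0 < δ) : ∃ n, m ≤ n ∧ c (n + m) ≤ (1 + δ) * c n := by
  by_contra! h
  have hlog : 0 < Real.log (1 + δ) := Real.log_pos (by linarith)
  -- Otherwise `c` grows geometrically along the progression m + jm.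
  have grow : ∀ j : ℕ, j * Real.log (1 + δ) ≤ Real.log (c (m + j * m)) := by
    intro j
    induction j with
    | zero => simpa using Real.log_nonneg (hpos m)
    | succ j ih =>
      have hstep := h (m + j * m) (by omega)
      have hle := Real.log_le_log (by have := hpos (m + j * m); positivity) hstep.le
      rw [Real.log_mul (by positivity) (by have := hpos (m + j * m); positivity)] at hle
      have : m + (j + 1) * m = m + j * m + m := by ring
      rw [this]
      push_cast
      linarith
  obtain ⟨N, hN⟩ := eventually_atTop.1 (hsub (Real.log (1 + δ) / (2 * (m + 1))) (by positivity))
  rcases Nat.eq_zero_or_pos m with rfl | hm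
  · have := h N (by omega)
    have := hpos N
    simp only [add_zero] at *
    nlinarith
  have hm' : (1 : ℝ) ≤ m := by exact_mod_cast hm
  have h1 := grow (N + 2 * m + 2)
  have h2 := hN (m + (N + 2 * m + 2) * m) (by nlinarith)
  have h3 := h1.trans h2
  rw [div_mul_eq_mul_div, le_div_iff₀ (by positivity)] at h3
  have h4 : ((N + 2 * m + 2 : ℕ) : ℝ) * (2 * (m + 1)) ≤ (m + (N + 2 * m + 2) * m : ℕ) := by
    apply le_of_mul_le_mul_right _ hlog
    linarith
  push_cast at h4
  have hN0 : (0 : ℝ) ≤ N := Nat.cast_nonneg N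
  nlinarith

/-- A group exhausted by an increasing sequence of finite sets `B n` with `B m * B n ⊆ B (m + n)`
and of subexponential growth is amenable. -/
theorem isAmenable_of_subexponential {G : Type*} [Group G] (B : ℕ → Finset G)
    (hmono : Monotone B) (hcover : ∀ g, ∃ n, g ∈ B n)
    (hmul : ∀ m n, ∀ g ∈ B m, ∀ h ∈ B n, g * h ∈ B (n + m)) (hone : ∀ n, 1 ∈ B n)
    (hsub : ∀ ε : ℝ, 0 < ε → ∀ᶠ n : ℕ in atTop, Real.log ((B n).card : ℝ) ≤ ε * n) :
    IsAmenable G := by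
  classical
  have hpos : ∀ n, (1 : ℝ) ≤ (B n).card := fun n => by
    exact_mod_cast Finset.card_pos.2 ⟨1, hone n⟩
  refine ⟨?_, ?_⟩
  · have hu : (⋃ n, (B n : Set G)) = Set.univ := by
      ext g; simpa using hcover g
    rw [← Set.countable_univ_iff, ← hu]
    exact Set.countable_iUnion fun n => (B n).countable_toSet
  -- Diagonal choice: stage `j` allows translation by all of `B j` with relative error 1/(j+1).
  choose N hN hNle using fun j : ℕ =>
    exists_ratio_le_of_subexponential (c := fun n => ((B n).card : ℝ)) hpos hsub j
      (δ := 1 / ((j : ℝ) + 1)) (by positivity)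
  refine ⟨fun j => B (N j), ?_, ?_⟩
  · intro g
    obtain ⟨m, hm⟩ := hcover g
    filter_upwards [eventually_ge_atTop m] with j hj
    exact hmono (hj.trans (hN j)) hm
  · intro g
    obtain ⟨m, hm⟩ := hcover g
    have hlim : Tendsto (fun j : ℕ => 2 * (1 / ((j : ℝ) + 1))) atTop (𝓝 0) := by
      simpa using (tendsto_one_div_add_atTop_nhds_zero_nat (𝕜 := ℝ)).const_mul 2
    refine squeeze_zero' (Eventually.of_forall fun j => by positivity) ?_ hlim
    filter_upwards [eventually_ge_atTop m] with j hj
    have hpos' := hpos (N j)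
    rw [div_le_iff₀ (by linarith)]
    have hsubset : g • B (N j) ⊆ B (N j + j) := by
      intro x hx
      obtain ⟨b, hb, rfl⟩ := Finset.mem_smul_finset.1 hx
      exact hmono (by omega) (hmul m (N j) g hm b hb)
    have hsubset' : B (N j) ⊆ B (N j + j) := hmono (by omega)
    have hcard : (g • B (N j)).card = (B (N j)).card := Finset.card_smul_finset g _
    have h1 : ((B (N j) ∆ (g • B (N j))).card : ℝ) ≤
        (B (N j) \ (g • B (N j))).card + ((g • B (N j)) \ B (N j)).card := by
      exact_mod_cast Finset.card_union_le _ _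
    have h2 : (((B (N j)) \ (g • B (N j))).card : ℝ) + (B (N j)).card ≤ (B (N j + j)).card := by
      rw [← hcard]
      exact_mod_cast (Finset.card_union_of_disjoint Finset.sdiff_disjoint).symm.trans_le
        (Finset.card_le_card (Finset.union_subset (Finset.sdiff_subset.trans hsubset') hsubset))
    have h3 : (((g • B (N j)) \ B (N j)).card : ℝ) + (B (N j)).card ≤ (B (N j + j)).card := by
      exact_mod_cast (Finset.card_union_of_disjoint Finset.sdiff_disjoint).symm.trans_le
        (Finset.card_le_card (Finset.union_subset (Finset.sdiff_subset.trans hsubset) hsubset'))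
    have h4 := hNle j
    have h5 : ((B (N j) ∆ (g • B (N j))).card : ℝ) ≤ 2 * (1 / ((j : ℝ) + 1)) * (B (N j)).card := by
      linarith
    convert h5

end Folner

end SubshiftAut

namespace SubshiftAut

open SymbolicDynamics.FullShift

/-! ### Automorphisms as sliding block codes -/

section Range

variable {A : Type*} [TopologicalSpace A] {X : Subshift A ℤ}

/-- The shift by `i` as a self-map of the subshift `X`. -/
def shiftBy (i : ℤ) (x : Points X) : Points X := ⟨shift i x.1, X.mapsTo i x.2⟩

@[simp]
theorem shiftBy_apply (i j : ℤ) (x : Points X) : (shiftBy i x).1 j = x.1 (i + j) := rfl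

theorem shiftHomeo_zpow_apply (i : ℤ) (x : Points X) : (shiftHomeo X ^ i) x = shiftBy i x := by
  induction i generalizing x with
  | zero => ext j; simp
  | succ i ih =>
    rw [zpow_add_one, Homeomorph.mul_apply, ih]
    ext j
    change x.1 (1 + (i + j)) = x.1 (i + 1 + j)
    ring_nf
  | pred i ih =>
    rw [zpow_sub_one, Homeomorph.mul_apply, ih]
    ext j
    change x.1 (-1 + (-i + j)) = x.1 (-i - 1 + j)
    ring_nf

theorem Aut.map_shiftBy (φ : Aut X) (i : ℤ) (x : Points X) :
    φ.1 (shiftBy i x) = shiftBy i (φ.1 x) := by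
  have h : Commute φ.1 (shiftHomeo X) :=
    (Subgroup.mem_centralizer_iff.1 φ.2 _ rfl).symm
  have h' := DFunLike.congr_fun (h.zpow_right i).eq x
  simpa only [Homeomorph.mul_apply, shiftHomeo_zpow_apply] using h'

/-- The coordinate at `0` of `f x` depends only on the coordinates of `x` in `[-r, r]`. -/
def HasRange (r : ℕ) (f : Points X → Points X) : Prop :=
  ∀ x y : Points X, (∀ j : ℤ, -r ≤ j → j ≤ r → x.1 j = y.1 j) → (f x).1 0 = (f y).1 0

theorem HasRange.mono {r s : ℕ} {f : Points X → Points X} (h : HasRange r f) (hrs : r ≤ s) :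
    HasRange s f :=
  fun x y hxy => h x y fun j h1 h2 => hxy j (by omega) (by omega)

theorem HasRange.apply_eq {r : ℕ} {φ : Aut X} (h : HasRange r φ.1) {x y : Points X} {i : ℤ}
    (hxy : ∀ j, i - r ≤ j → j ≤ i + r → x.1 j = y.1 j) : (φ.1 x).1 i = (φ.1 y).1 i := by
  have := h (shiftBy i x) (shiftBy i y) fun j h1 h2 => hxy _ (by omega) (by omega)
  simpa [Aut.map_shiftBy] using this

theorem HasRange.mul {r s : ℕ} {φ ψ : Aut X} (hφ : HasRange r φ.1) (hψ : HasRange s ψ.1) :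
    HasRange (r + s) (φ * ψ).1 := by
  intro x y hxy
  refine hφ (ψ.1 x) (ψ.1 y) fun j h1 h2 => hψ.apply_eq fun l h3 h4 => hxy l ?_ ?_ <;>
    push_cast <;> omega

theorem hasRange_one (r : ℕ) : HasRange r (1 : Aut X).1 :=
  fun _ _ hxy => hxy 0 (by omega) (by omega)

/-- A continuous self-map of a subshift over a finite alphabet has finite range. -/
theorem exists_hasRange [Finite A] [DiscreteTopology A] {f : Points X → Points X}
    (hf : Continuous f) : ∃ r, HasRange r f := by
  have : CompactSpace (Points X) := isCompact_iff_compactSpace.1 X.isClosed.isCompact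
  by_contra! h
  -- Compactness: a pair in all of these nested closed sets would consist of equal points with
  -- different images.
  let K : ℕ → Set (Points X × Points X) := fun r =>
    {q | (∀ j : ℤ, -r ≤ j → j ≤ r → q.1.1 j = q.2.1 j) ∧ (f q.1).1 0 ≠ (f q.2).1 0}
  have hcoord : ∀ j : ℤ, Continuous fun x : Points X => x.1 j := fun j =>
    (continuous_apply j).comp continuous_subtype_val
  have hclosed : ∀ r, IsClosed (K r) := by
    intro r
    have hne : IsClosed {q : Points X × Points X | (f q.1).1 0 ≠ (f q.2).1 0} := by
      have : Continuous fun q : Points X × Points X => ((f q.1).1 0, (f q.2).1 0) :=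
        ((hcoord 0).comp (hf.comp continuous_fst)).prodMk
          ((hcoord 0).comp (hf.comp continuous_snd))
      exact (isClosed_discrete {a : A × A | a.1 ≠ a.2}).preimage this
    have heq : IsClosed {q : Points X × Points X |
        ∀ j : ℤ, -r ≤ j → j ≤ r → q.1.1 j = q.2.1 j} := by
      simp only [Set.ofPred_forall]
      exact isClosed_iInter fun j => isClosed_iInter fun _ => isClosed_iInter fun _ =>
        isClosed_eq ((hcoord j).comp continuous_fst) ((hcoord j).comp continuous_snd)
    exact heq.inter hne
  have hnonempty : ∀ r, (K r).Nonempty := by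
    intro r
    have := h r
    simp only [HasRange, not_forall] at this
    obtain ⟨x, y, hxy, hne⟩ := this
    exact ⟨(x, y), hxy, hne⟩
  obtain ⟨q, hq⟩ := IsCompact.nonempty_iInter_of_sequence_nonempty_isCompact_isClosed K
    (fun r q hq => ⟨fun j h1 h2 => hq.1 j (by push_cast; omega) (by push_cast; omega), hq.2⟩)
    hnonempty (hclosed 0).isCompact hclosed
  rw [Set.mem_iInter] at hq
  refine (hq 0).2 ?_
  have : q.1 = q.2 := by
    ext j
    exact (hq j.natAbs).1 j (by omega) (by omega)
  rw [this]

/-- The automorphisms `φ` such that `φ` and `φ⁻¹` have range `r`. -/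
def autRange (X : Subshift A ℤ) (r : ℕ) : Set (Aut X) :=
  {φ | HasRange r φ.1 ∧ HasRange r (φ⁻¹).1}

theorem autRange_mono : Monotone (autRange X) :=
  fun _ _ hrs _ hφ => ⟨hφ.1.mono hrs, hφ.2.mono hrs⟩

theorem one_mem_autRange (r : ℕ) : 1 ∈ autRange X r :=
  ⟨hasRange_one r, by rw [inv_one]; exact hasRange_one r⟩

theorem mul_mem_autRange {r s : ℕ} {φ ψ : Aut X} (hφ : φ ∈ autRange X r)
    (hψ : ψ ∈ autRange X s) : φ * ψ ∈ autRange X (r + s) := by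
  refine ⟨hφ.1.mul hψ.1, ?_⟩
  rw [mul_inv_rev, add_comm]
  exact hψ.2.mul hφ.2

theorem exists_mem_autRange [Finite A] [DiscreteTopology A] (φ : Aut X) :
    ∃ r, φ ∈ autRange X r := by
  obtain ⟨r, hr⟩ := exists_hasRange φ.1.continuous
  obtain ⟨s, hs⟩ := exists_hasRange (φ⁻¹).1.continuous
  exact ⟨max r s, hr.mono (le_max_left r s), hs.mono (le_max_right r s)⟩

end Range

/-! ### Right special words and rigidity -/

section RightSpecial

variable {A : Type*} [TopologicalSpace A] {X : Subshift A ℤ}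

/-- The word `x₀ … x_{k-1}` is right special in `X`: it is followed by a letter other than `x_k`
in some point of `X`. -/
def RightSpecial (k : ℕ) (x : Points X) : Prop :=
  ∃ y : Points X, (∀ j : ℤ, 0 ≤ j → j < k → y.1 j = x.1 j) ∧ y.1 k ≠ x.1 k

theorem apply_eq_of_not_rightSpecial {k : ℕ} {x y : Points X} {i l : ℤ}
    (h : ¬ RightSpecial k (shiftBy i x))
    (hxy : ∀ j : ℤ, 0 ≤ j → j < k → y.1 (l + j) = x.1 (i + j)) :
    y.1 (l + k) = x.1 (i + k) := by
  by_contra hne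
  exact h ⟨shiftBy l y, hxy, hne⟩

theorem iterate_shift_one {A : Type*} (p : ℕ) (x : ℤ → A) : (shift (1 : ℤ))^[p] x = shift (p : ℤ) x := by
  induction p with
  | zero => simp
  | succ p ih =>
    rw [Function.iterate_succ_apply', ih]
    ext j
    simp only [shift_apply]
    push_cast; ring_nf

/-- An aperiodic point contains right special words of any positive length arbitrarily far to the
left. -/
theorem IsAperiodic.exists_rightSpecial_le [Finite A] {x : Points X} (hx : IsAperiodic x.1)
    {k : ℕ} (hk : 0 < k) (m : ℤ) : ∃ i ≤ m, RightSpecial k (shiftBy i x) := by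
  by_contra! hns
  -- Pigeonhole: one word `w` of length `k` starts at `m - q` for infinitely many `q`.
  obtain ⟨w, hw⟩ := Finite.exists_infinite_fiber
    fun (q : ℕ) (j : Fin k) => x.1 (m - q + j)
  set S : Set ℕ := (fun (q : ℕ) (j : Fin k) => x.1 (m - q + j)) ⁻¹' {w}
  have hS : S.Infinite := Set.infinite_coe_iff.1 hw
  -- Left of `m` each word forces its next letter, so equal words have equal continuations; only the
  -- window started at `m - q'` must stay left of `m`.
  have same : ∀ q ∈ S, ∀ q' ∈ S, ∀ t : ℕ, t ≤ q' → ∀ j : ℤ, 0 ≤ j → j < k →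
      x.1 (m - q + t + j) = x.1 (m - q' + t + j) := by
    intro q hq q' hq' t
    induction t with
    | zero =>
      intro _ j h0 h1
      have h := congrFun ((show _ = w from hq).trans (show _ = w from hq').symm)
        ⟨j.toNat, by omega⟩
      simp only [Int.toNat_of_nonneg h0] at h
      simpa using h
    | succ t ih =>
      intro ht j h0 h1
      have ih' := ih (by omega)
      by_cases hj : j + 1 < k
      · have := ih' (j + 1) (by omega) hj
        push_cast
        convert this using 2 <;> ring
      · obtain rfl : j = k - 1 := by omega
        have := apply_eq_of_not_rightSpecial (hns (m - q' + t) (by omega)) ih'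
        push_cast
        convert this using 2 <;> ring
  obtain ⟨a, ha⟩ := hS.nonempty
  obtain ⟨b, hb, hab⟩ := hS.exists_gt a
  -- Comparison with a start `Q > t` removes the bound on `t`: all rays starting at `m - q`, `q ∈
  -- S`, coincide, which makes `b - a` a period.
  have same' : ∀ q ∈ S, ∀ q' ∈ S, ∀ t : ℕ, x.1 (m - q + t) = x.1 (m - q' + t) := by
    intro q hq q' hq' t
    obtain ⟨Q, hQ, htQ⟩ := hS.exists_gt t
    have h1 := same q hq Q hQ t htQ.le 0 le_rfl (by omega)
    have h2 := same q' hq' Q hQ t htQ.le 0 le_rfl (by omega)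
    simpa using h1.trans h2.symm
  refine hx (b - a) (by omega) ?_
  rw [iterate_shift_one]
  ext i
  obtain ⟨q, hq, hqi⟩ := hS.exists_gt (m - i).natAbs
  have h1 := same' q hq b hb (i - m + q).toNat
  have h2 := same' q hq a ha (i - m + q).toNat
  have h3 := same' a ha q hq (i - m + q + (b - a)).toNat
  have h4 := same' a ha b hb (i - m + q + (b - a)).toNat
  rw [Int.toNat_of_nonneg (by omega)] at h1 h2 h3 h4
  rw [shift_apply, Nat.cast_sub hab.le]
  calc x.1 ((b : ℤ) - a + i) = x.1 (m - q + (i - m + q + (b - a))) := by ring_nf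
    _ = x.1 (m - b + (i - m + q + (b - a))) := h3.symm.trans h4
    _ = x.1 (m - a + (i - m + q)) := by ring_nf
    _ = x.1 (m - q + (i - m + q)) := h2.symm
    _ = x.1 i := by ring_nf

/-- An automorphism of range `n` that fixes the coordinates in `[n, n + k)` of one point in each
cylinder of length `k + 1` above a right special word of length `k ≥ 2 n` is the identity. -/
theorem eq_one_of_fixes_rightSpecial [Finite A] [DiscreteTopology A]
    (hdense : HasDenseAperiodicPoints X) {θ : Aut X} {n k : ℕ} (hθ : HasRange n θ.1)
    (hn : 0 < n) (hnk : 2 * n ≤ k)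
    (hfix : ∀ x : Points X, RightSpecial k x → ∃ z : Points X,
      (∀ j : ℤ, 0 ≤ j → j ≤ k → z.1 j = x.1 j) ∧
      ∀ j : ℤ, n ≤ j → j < n + k → (θ.1 z).1 j = z.1 j) : θ = 1 := by
  have hk : 0 < k := by omega
  have hap : ∀ x : Points X, IsAperiodic x.1 → θ.1 x = x := by
    intro x hx
    ext m
    -- The last right special position up to `m - n`; the margin `n` puts `m` in the range `i + n ≤
    -- m` where `θ x` is controlled.
    obtain ⟨i, ⟨him, hi⟩, hmax⟩ := Int.exists_greatest_of_bdd
      (P := fun i => i ≤ m - n ∧ RightSpecial k (shiftBy i x)) ⟨m - n, fun z hz => hz.1⟩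
      (hx.exists_rightSpecial_le hk (m - n))
    obtain ⟨z, hz, hθz⟩ := hfix _ hi
    have hns : ∀ t : ℤ, 1 ≤ t → t ≤ m - n - i → ¬ RightSpecial k (shiftBy (i + t) x) := by
      intro t h1 h2 h3
      have := hmax (i + t) ⟨by omega, h3⟩
      omega
    have hagree : ∀ t : ℕ, (t : ℤ) ≤ m - n - i → ∀ j : ℤ, 0 ≤ j → j ≤ k + t →
        z.1 j = x.1 (i + j) := by
      intro t
      induction t with
      | zero => exact fun _ j h0 h1 => hz j h0 (by simpa using h1)
      | succ t ih =>
        intro ht j h0 h1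
        push_cast at ht h1
        have ih' := ih (by omega)
        rcases eq_or_lt_of_le h1 with rfl | h1
        · have := apply_eq_of_not_rightSpecial (y := z) (l := t + 1)
            (hns (t + 1) (by omega) ht) fun j h0 h1 => by
              rw [ih' _ (by omega) (by omega)]; ring_nf
          convert this using 2 <;> ring
        · exact ih' j h0 (by omega)
    -- On the first `k` coordinates `θ x` copies `θ z = z`; the local rule sees up to `s + n ≤ k +
    -- (s - n)`, whence `2 * n ≤ k`. Beyond them, `k` correct letters of `θ x` force the next one,
    -- since the word of `x` there is not right special.
    have hmain : ∀ s : ℕ, n ≤ s → (s : ℤ) ≤ m - i →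
        (θ.1 x).1 (i + s) = x.1 (i + s) := by
      intro s
      induction s using Nat.strong_induction_on with
      | _ s ih =>
        intro hns' hsm
        by_cases hs : s < n + k
        · have hloc : (θ.1 z).1 s = (θ.1 (shiftBy i x)).1 s :=
            hθ.apply_eq fun j h1 h2 =>
              hagree (s - n) (by omega) j (by omega) (by omega)
          rw [Aut.map_shiftBy, hθz s (by omega) (by omega)] at hloc
          rw [← shiftBy_apply i, ← hloc]
          exact hagree (s - n) (by omega) s (by omega) (by omega)
        · have := apply_eq_of_not_rightSpecial (y := θ.1 x) (l := i + (s - k))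
            (hns (s - k) (by omega) (by omega)) fun j h0 h1 => by
              have := ih (s - k + j).toNat (by omega) (by omega) (by omega)
              rw [Int.toNat_of_nonneg (by omega)] at this
              convert this using 2 <;> ring
          convert this using 2 <;> ring
    have := hmain (m - i).toNat (by omega) (by omega)
    rw [Int.toNat_of_nonneg (by omega)] at this
    simpa using this
  have hext : (θ.1 : Points X → Points X) = id :=
    Continuous.ext_on hdense θ.1.continuous continuous_id hap
  exact Subtype.ext (Homeomorph.ext fun x => congrFun hext x)

end RightSpecial

end SubshiftAut

namespace SubshiftAut

open SymbolicDynamics.FullShift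

/-! ### Counting automorphisms through the complexity -/

section Counting

/-- In a finite set `s`, the elements that are not alone in their fibre under `f` number at most
twice the difference between the sizes of `s` and its image. -/
theorem card_filter_not_alone_add_le {α β : Type*} [DecidableEq α] [DecidableEq β]
    (s : Finset α) (f : α → β) :
    (s.filter fun u => ∃ v ∈ s, f v = f u ∧ v ≠ u).card + 2 * (s.image f).card ≤ 2 * s.card := by
  set Z := s.filter fun u => ∃ v ∈ s, f v = f u ∧ v ≠ u
  have hs : s.card = ∑ b ∈ s.image f, (s.filter fun a => f a = b).card :=
    Finset.card_eq_sum_card_fiberwise fun a ha => by simpa using ⟨a, ha, rfl⟩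
  have hZ : Z.card = ∑ b ∈ s.image f, (Z.filter fun a => f a = b).card :=
    Finset.card_eq_sum_card_fiberwise fun a ha => by
      simpa using ⟨a, (Finset.mem_filter.1 ha).1, rfl⟩
  rw [hs, hZ, Finset.card_eq_sum_ones, Finset.mul_sum, Finset.mul_sum, ← Finset.sum_add_distrib]
  refine Finset.sum_le_sum fun b hb => ?_
  obtain ⟨a, ha, rfl⟩ := Finset.mem_image.1 hb
  have hle : (Z.filter fun c => f c = f a).card ≤ (s.filter fun c => f c = f a).card :=
    Finset.card_le_card (Finset.filter_subset_filter _ (Finset.filter_subset _ _))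
  have hpos : 0 < (s.filter fun c => f c = f a).card :=
    Finset.card_pos.2 ⟨a, by simp [ha]⟩
  -- A fibre of size c ≥ 2 contributes c ≤ 2(c - 1); a singleton contributes nothing.
  rcases Nat.lt_or_ge 1 (s.filter fun c => f c = f a).card with h2 | h1
  · omega
  · have hempty : (Z.filter fun c => f c = f a) = ∅ := by
      refine Finset.filter_eq_empty_iff.2 fun c hc hca => ?_
      obtain ⟨hcs, v, hv, hvc, hne⟩ := Finset.mem_filter.1 hc
      exact hne (Finset.card_le_one.1 h1 v (by simp [hv, hvc, hca]) c (by simp [hcs, hca]))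
    rw [hempty, Finset.card_empty]
    omega

variable {A : Type*} [TopologicalSpace A] {X : Subshift A ℤ}

theorem word_mem_language (x : Points X) (i : ℤ) (n : ℕ) :
    (fun j : Fin n => x.1 (i + (j : ℕ))) ∈ language X n :=
  ⟨(shiftBy i x).1, (shiftBy i x).2, fun _ => rfl⟩

theorem image_init_language (X : Subshift A ℤ) (k : ℕ) :
    (fun (w : Fin (k + 1) → A) (j : Fin k) => w j.castSucc) '' language X (k + 1) =
      language X k := by
  ext w
  constructor
  · rintro ⟨u, ⟨x, hx, hxu⟩, rfl⟩
    exact ⟨x, hx, fun i => hxu i.castSucc⟩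
  · rintro ⟨x, hx, hxw⟩
    exact ⟨fun j => x (j : ℕ), ⟨x, hx, fun _ => rfl⟩, funext fun j => hxw j⟩

theorem complexity_mono [Finite A] : Monotone (complexity X) :=
  monotone_nat_of_le_succ fun k => by
    rw [complexity, ← image_init_language]
    exact Set.ncard_image_le (Set.toFinite _)

/-- The words of length `k + 1` whose prefix of length `k` is right special in `X`. -/
def specialExtensions (X : Subshift A ℤ) (k : ℕ) : Set (Fin (k + 1) → A) :=
  {u | ∃ x : Points X, RightSpecial k x ∧ ∀ i : Fin (k + 1), x.1 (i : ℕ) = u i}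

/-- A right special prefix has at least two extensions, so these words are not alone in their fibres
under deletion of the last letter, a map with image the language of length `k`. -/
theorem ncard_specialExtensions_add_le [Finite A] (X : Subshift A ℤ) (k : ℕ) :
    (specialExtensions X k).ncard + 2 * complexity X k ≤ 2 * complexity X (k + 1) := by
  classical
  have hfin : (language X (k + 1)).Finite := Set.toFinite _
  have h := card_filter_not_alone_add_le hfin.toFinset
    fun (w : Fin (k + 1) → A) (j : Fin k) => w j.castSucc
  have h1 : complexity X (k + 1) = hfin.toFinset.card := Set.ncard_eq_toFinset_card _ hfin
  have h2 : complexity X k = (hfin.toFinset.image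
      fun (w : Fin (k + 1) → A) (j : Fin k) => w j.castSucc).card := by
    rw [complexity, ← image_init_language, ← Set.ncard_coe_finset]
    simp
  rw [← h1, ← h2] at h
  refine le_trans (Nat.add_le_add_right ?_ _) h
  rw [← Set.ncard_coe_finset]
  refine Set.ncard_le_ncard ?_ (Finset.finite_toSet _)
  rintro u ⟨x, ⟨y, hyx, hne⟩, hxu⟩
  simp only [Finset.coe_filter, Set.Finite.mem_toFinset, Set.mem_ofPred_eq]
  refine ⟨⟨x.1, x.2, hxu⟩, fun j => y.1 (j : ℕ), ⟨y.1, y.2, fun _ => rfl⟩, ?_, ?_⟩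
  · funext j
    rw [← hxu]
    exact hyx _ (by simp) (by simp)
  · intro hyu
    have := congrFun hyu (Fin.last k)
    rw [← hxu] at this
    exact hne (by simpa using this)

/-- The automorphisms `φ` such that `φ` and `φ⁻¹` have range `r` are determined by the images of
`#(specialExtensions X k)` words. -/
theorem finite_autRange_and_ncard_le [Finite A] [DiscreteTopology A]
    (hdense : HasDenseAperiodicPoints X) {r k : ℕ} (hr : 0 < r) (hk : 4 * r ≤ k) :
    (autRange X r).Finite ∧
      (autRange X r).ncard ≤ complexity X (k + 2 * r) ^ (specialExtensions X k).ncard := by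
  choose z hzs hz using fun u : specialExtensions X k => u.2
  -- The window `[r, k + 3r)` is what `ψ⁻¹`, of range `r`, reads to determine `[2r, 2r + k)`, the
  -- coordinates that rigidity needs for `ψ⁻¹ * φ` of range `2r`.
  let data : autRange X r → specialExtensions X k → language X (k + 2 * r) :=
    fun φ u => ⟨_, word_mem_language (φ.1.1 (z u)) r (k + 2 * r)⟩
  have hinj : Function.Injective data := by
    rintro ⟨φ, hφ⟩ ⟨ψ, hψ⟩ heq
    have hwin : ∀ (u : specialExtensions X k) (j : ℤ), r ≤ j → j < k + 3 * r →
        (φ.1 (z u)).1 j = (ψ.1 (z u)).1 j := by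
      intro u j h1 h2
      have h := congrFun (congrArg Subtype.val (congrFun heq u)) ⟨(j - r).toNat, by omega⟩
      simp only [data, Int.toNat_of_nonneg (show (0 : ℤ) ≤ j - r by omega)] at h
      simpa using h
    have hone : ψ⁻¹ * φ = 1 := by
      refine eq_one_of_fixes_rightSpecial hdense (hψ.2.mul hφ.1) (n := r + r) (k := k)
        (by omega) (by omega) fun x hx => ?_
      let u : specialExtensions X k := ⟨fun i => x.1 (i : ℕ), x, hx, fun _ => rfl⟩
      refine ⟨z u, fun j h0 h1 => ?_, fun j h1 h2 => ?_⟩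
      · have := hz u ⟨j.toNat, by omega⟩
        simp only [u, Int.toNat_of_nonneg h0] at this
        exact this
      · push_cast at h1 h2
        have h3 : (ψ⁻¹.1 (φ.1 (z u))).1 j = (ψ⁻¹.1 (ψ.1 (z u))).1 j :=
          hψ.2.apply_eq fun l h3 h4 => hwin u l (by omega) (by omega)
        have h4 : ψ⁻¹.1 (ψ.1 (z u)) = z u := ψ.1.symm_apply_apply (z u)
        rw [h4] at h3
        exact h3
    exact Subtype.ext (inv_mul_eq_one.1 hone).symm
  refine ⟨Set.finite_coe_iff.1 (Finite.of_injective data hinj), ?_⟩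
  have := Nat.card_le_card_of_injective data hinj
  rwa [Nat.card_fun, Nat.card_coe_set_eq, Nat.card_coe_set_eq, Nat.card_coe_set_eq] at this

/-- Some increment of a monotone function on an interval is at most the average one. -/
theorem exists_increment_mul_le {P : ℕ → ℕ} (hP : Monotone P) (a : ℕ) {l : ℕ} (hl : 0 < l) :
    ∃ k, a ≤ k ∧ k < a + l ∧ (P (k + 1) - P k) * l ≤ P (a + l) := by
  by_contra! h
  have hsum : ∀ j ≤ l, j * P (a + l) + l * P a ≤ l * P (a + j) := by
    intro j
    induction j with
    | zero => simp
    | succ j ih =>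
      intro hj
      have h1 := h (a + j) (by omega) (by omega)
      have h2 := ih (by omega)
      have h3 : P (a + j) ≤ P (a + j + 1) := hP (by omega)
      obtain ⟨d, hd⟩ := Nat.exists_eq_add_of_le h3
      rw [hd, Nat.add_sub_cancel_left] at h1
      rw [← add_assoc a j 1, hd]
      nlinarith
  -- The sum over all `l` steps is only a weak inequality, no contradiction if `P a = 0`; the last
  -- increment is therefore used in its strict form.
  obtain ⟨m, rfl⟩ : ∃ m, l = m + 1 := ⟨l - 1, by omega⟩
  have h1 := hsum m (by omega)
  have h2 := h (a + m) (by omega) (by omega)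
  have h3 : P (a + m) ≤ P (a + m + 1) := hP (by omega)
  obtain ⟨d, hd⟩ := Nat.exists_eq_add_of_le h3
  rw [hd, Nat.add_sub_cancel_left] at h2
  rw [← add_assoc a m 1, hd] at h1 h2
  nlinarith

theorem log_ncard_autRange_le [Finite A] [DiscreteTopology A]
    (hdense : HasDenseAperiodicPoints X) {r : ℕ} (hr : 0 < r) :
    Real.log ((autRange X r).ncard : ℝ) ≤
      complexity X (8 * r) / (2 * r) * Real.log (complexity X (10 * r)) := by
  obtain ⟨k, hk, hk', hinc⟩ := exists_increment_mul_le (complexity_mono (X := X)) (4 * r)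
    (l := 4 * r) (by omega)
  rw [show 4 * r + 4 * r = 8 * r by ring] at hinc hk'
  have hspecial := ncard_specialExtensions_add_le X k
  obtain ⟨hfin, hcard⟩ := finite_autRange_and_ncard_le hdense hr hk
  have hpos : 0 < (autRange X r).ncard :=
    (Set.ncard_pos hfin).2 ⟨1, one_mem_autRange r⟩
  set s := (specialExtensions X k).ncard
  have hs : (s : ℝ) ≤ complexity X (8 * r) / (2 * r) := by
    rw [le_div_iff₀ (by positivity)]
    have : s * (2 * r) ≤ complexity X (8 * r) := by
      refine le_trans ?_ hinc
      have : s ≤ 2 * (complexity X (k + 1) - complexity X k) := by omega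
      nlinarith
    exact_mod_cast this
  calc Real.log ((autRange X r).ncard : ℝ)
      ≤ Real.log ((complexity X (k + 2 * r) : ℝ) ^ s) :=
        Real.log_le_log (by exact_mod_cast hpos) (by exact_mod_cast hcard)
    _ = s * Real.log (complexity X (k + 2 * r)) := by rw [Real.log_pow]
    _ ≤ s * Real.log (complexity X (10 * r)) := by
        refine mul_le_mul_of_nonneg_left ?_ (Nat.cast_nonneg s)
        rcases Nat.eq_zero_or_pos (complexity X (k + 2 * r)) with h0 | h0
        -- For the empty subshift the convention `Real.log 0 = 0` applies.
        · rw [h0, Nat.cast_zero, Real.log_zero]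
          exact Real.log_natCast_nonneg _
        · exact Real.log_le_log (by exact_mod_cast h0)
            (by exact_mod_cast complexity_mono (by omega))
    _ ≤ _ := mul_le_mul_of_nonneg_right hs (Real.log_natCast_nonneg _)

open Filter in
theorem log_ncard_autRange_subexponential [Finite A] [DiscreteTopology A]
    (hdense : HasDenseAperiodicPoints X)
    (hcomplexity : (fun n : ℕ => (complexity X n : ℝ)) =o[atTop]
      fun n : ℕ => (n : ℝ) ^ 2 / Real.log n ^ 2) {ε : ℝ} (hε : 0 < ε) :
    ∀ᶠ r : ℕ in atTop, Real.log ((autRange X r).ncard : ℝ) ≤ ε * r := by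
  have hbound : ∀ δ : ℝ, 0 < δ → ∀ c : ℕ, 0 < c → ∀ᶠ r : ℕ in atTop,
      (complexity X (c * r) : ℝ) ≤
        δ * (((c * r : ℕ) : ℝ) ^ 2 / Real.log ((c * r : ℕ) : ℝ) ^ 2) := by
    intro δ hδ c hc
    have htend : Tendsto (fun r : ℕ => c * r) atTop atTop :=
      tendsto_id.const_mul_atTop' hc
    filter_upwards [htend.eventually (hcomplexity.bound hδ)] with r hr
    rw [Real.norm_of_nonneg (by positivity), Real.norm_of_nonneg (by positivity)] at hr
    exact hr
  -- The constant is 128 = 64 · 4 / 2: from (8r)², from log P(10r) ≤ 4 log(8r), and from the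
  -- denominator 2r. A factor 1 / log(8r) remains to spare.
  filter_upwards [hbound (ε / 128) (by positivity) 8 (by norm_num),
    hbound 1 one_pos 10 (by norm_num), eventually_ge_atTop 3] with r h8 h10 hr
  have hr' : (3 : ℝ) ≤ r := by exact_mod_cast hr
  push_cast at h8 h10
  have hlog3 : (1 : ℝ) ≤ Real.log (8 * r) := by
    rw [Real.le_log_iff_exp_le (by positivity)]
    linarith [Real.exp_one_lt_d9]
  set l := Real.log (8 * (r : ℝ)) with hl
  have hl10 : l ≤ Real.log (10 * r) := Real.log_le_log (by positivity) (by linarith)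
  have hl10' : Real.log (10 * (r : ℝ)) ≤ 2 * l := by
    have : 2 * l = Real.log ((8 * (r : ℝ)) ^ 2) := by rw [Real.log_pow]; push_cast; rfl
    rw [this]
    exact Real.log_le_log (by positivity) (by nlinarith)
  have hP10 : Real.log (complexity X (10 * r)) ≤ 4 * l := by
    rcases Nat.eq_zero_or_pos (complexity X (10 * r)) with h0 | h0
    · rw [h0, Nat.cast_zero, Real.log_zero]
      linarith
    have h1 : (complexity X (10 * r) : ℝ) ≤ (10 * r) ^ 2 := by
      rw [one_mul] at h10
      exact h10.trans (div_le_self (by positivity) (one_le_pow₀ (by linarith)))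
    have h2 := Real.log_le_log (by exact_mod_cast h0) h1
    rw [Real.log_pow] at h2
    push_cast at h2
    linarith
  calc Real.log ((autRange X r).ncard : ℝ)
      ≤ complexity X (8 * r) / (2 * r) * Real.log (complexity X (10 * r)) :=
        log_ncard_autRange_le hdense (by omega)
    _ ≤ (ε / 128 * ((8 * r) ^ 2 / l ^ 2)) / (2 * r) * (4 * l) := by
        gcongr
    _ = ε * r / l := by
        field_simp
        ring
    _ ≤ ε * r := div_le_self (by positivity) hlog3

end Counting

end SubshiftAut

theorem theorem4p1 {A : Type*} [Finite A] [TopologicalSpace A] [DiscreteTopology A]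
    (X : SymbolicDynamics.FullShift.Subshift A ℤ)
    (hdense : SubshiftAut.HasDenseAperiodicPoints X)
    (hcomplexity : (fun n : ℕ => (SubshiftAut.complexity X n : ℝ)) =o[Filter.atTop]
      fun n : ℕ => (n : ℝ) ^ 2 / Real.log n ^ 2) :
    SubshiftAut.IsAmenable (SubshiftAut.Aut X) := by
  open SubshiftAut in
  -- Passing to range `r + 1` covers `r = 0`, since the count needs positive range.
  have hfin : ∀ r, (autRange X r).Finite := fun r =>
    (finite_autRange_and_ncard_le hdense (Nat.succ_pos r) le_rfl).1.subset
      (autRange_mono (Nat.le_succ r))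
  refine SubshiftAut.isAmenable_of_subexponential (fun r => (hfin r).toFinset) ?_ ?_ ?_ ?_ ?_
  · intro r s hrs
    exact Set.Finite.toFinset_mono (SubshiftAut.autRange_mono hrs)
  · simpa using SubshiftAut.exists_mem_autRange
  · intro r s φ hφ ψ hψ
    rw [Set.Finite.mem_toFinset] at *
    rw [add_comm]
    exact SubshiftAut.mul_mem_autRange hφ hψ
  · simpa using SubshiftAut.one_mem_autRange
  · intro ε hε
    simpa only [← Set.ncard_eq_toFinset_card] using
      SubshiftAut.log_ncard_autRange_subexponential hdense hcomplexity hε
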